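/- Let $(\Omega,\mathcal F,P)$ be a nonatomic probability space, i.e. one that supports a random variable with a continuous distribution function, and write $L^\infty(P)=L^\infty(\Omega,\mathcal F,P)$. A map $\rho:L^\infty(P)\to\mathbb R$ is a monetary risk measure if $X\le Y$ $P$-a.s. implies $\rho(X)\ge\rho(Y)$, and $\rho(X+m)=\rho(X)-m$ for all $m\in\mathbb R$. It is law-invariant if $\rho(X)=\rho(Y)$ whenever $X$ and $Y$ have the same distribution under $P$. Two elements $X,Y\in L^\infty(P)$ are comonotonic if there is $\Omega_0\in\mathcal F$ with $P(\Omega_0)=1$ and $(X(\omega)-X(\omega'))(Y(\omega)-Y(\omega'))\ge 0$ for all $\omega,\omega'\in\Omega_0$. A monetary risk measure $\rho$ is CoM-convex if $\rho(aX+(1-a)Y)\le a\rho(X)+(1-a)\rho(Y)$ for all comonotonic $X,Y$ and all $a\in[0,1]$, and CoM-coherent if moreover $\rho(aX)=a\rho(X)$ for all $X\in L^\infty(P)$ and $a\ge 0$. For $X\in L^\infty(P)$ with distribution function $F_X$, let $q_X(t)=\inf\{x\in\mathbb R: F_X(x)>t\}$ for $t\in[0,1)$, $q_X(1)=\lim_{t\uparrow1}q_X(t)$,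 and $\mathrm{VaR}_t(X)=-q_X(t)$ for $t\in[0,1]$. Let $\ell$ be Lebesgue measure on the Borel sets of $[0,1]$, and let $\mathcal M_{1,f}(\ell)$ be the set of all finitely additive probability measures on the Borel sets of $[0,1]$ that vanish on $\ell$-null sets, with the weak* topology, i.e. the coarsest topology making $\mu\mapsto\int f\,d\mu$ continuous for every $f\in L^\infty([0,1],\ell)$. (1) If $\rho:L^\infty(P)\to\mathbb R$ is a law-invariant CoM-convex risk measure, then there is a lower semicontinuous convex functional $\alpha:\mathcal M_{1,f}(\ell)\to(-\infty,\infty]$ such that $$\rho(X)=\max_{\mu\in\mathcal M_{1,f}(\ell)}\Bigl(\int_0^1\mathrm{VaR}_t(X)\,\mu(dt)-\alpha(\mu)\Bigr)\quad\text{for all }X\in L^\infty(P),$$ the maximum being attained. (2) If $\rho:L^\infty(P)\to\mathbb R$ is a law-invariant CoM-coherent risk measure, then there is a nonempty, weak*-compact, convex set $\mathcal M\subseteq\mathcal M_{1,f}(\ell)$ such that $$\rho(X)=\max_{\mu\in\mathcal M}\int_0^1\mathrm{VaR}_t(X)\,\mu(dt)\quad\text{for all }X\in L^\infty(P),$$ the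 maximum being attained. -/

import Mathlib

open MeasureTheory ProbabilityTheory Topology
open scoped ENNReal unitInterval

noncomputable section

/-- Finitely additive probability measures on a measurable space that are absolutely continuous
with respect to `ℓ`. As for Mathlib's vector measures, the value on a non-measurable set is
set to `0`, so that such an object is determined by its values on the measurable sets. -/
structure FinAddProb {S : Type*} [MeasurableSpace S] (ℓ : Measure S) where
  toFun : Set S → ℝ
  nonneg : ∀ A, 0 ≤ toFun A
  univ : toFun Set.univ = 1
  union : ∀ A B, MeasurableSet A → MeasurableSet B → Disjoint A B →
    toFun (A ∪ B) = toFun A + toFun B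
  abs_cont : ∀ A, MeasurableSet A → ℓ A = 0 → toFun A = 0
  not_measurable : ∀ A, ¬ MeasurableSet A → toFun A = 0

namespace FinAddProb

variable {S : Type*} [MeasurableSpace S] {ℓ : Measure S}

/-- The integral of a simple function with respect to a finitely additive probability. -/
def simpleIntegral (μ : FinAddProb ℓ) (s : SimpleFunc S ℝ) : ℝ :=
  ∑ y ∈ s.range, y * μ.toFun (s ⁻¹' {y})

/-- The integral of a (measurable, `ℓ`-essentially bounded) function with respect to a
finitely additive probability that is absolutely continuous with respect to `ℓ`: the supremum
of the integrals of the simple functions that are `ℓ`-a.e. below it. -/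
def integral (μ : FinAddProb ℓ) (f : S → ℝ) : ℝ :=
  sSup {r : ℝ | ∃ s : SimpleFunc S ℝ, (⇑s ≤ᵐ[ℓ] f) ∧ r = μ.simpleIntegral s}

/-- The weak* topology: the coarsest topology for which `μ ↦ ∫ f dμ` is continuous for
every `f ∈ L^∞(ℓ)`. -/
instance : TopologicalSpace (FinAddProb ℓ) :=
  ⨅ f : Lp ℝ ∞ ℓ, TopologicalSpace.induced (fun μ : FinAddProb ℓ => μ.integral f) inferInstance

/-- The convex combination `a μ + b ν`. -/
def convexComb (a b : ℝ) (ha : 0 ≤ a) (hb : 0 ≤ b) (hab : a + b = 1) (μ ν : FinAddProb ℓ) :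
    FinAddProb ℓ where
  toFun A := a * μ.toFun A + b * ν.toFun A
  nonneg A := add_nonneg (mul_nonneg ha (μ.nonneg A)) (mul_nonneg hb (ν.nonneg A))
  univ := by rw [μ.univ, ν.univ, mul_one, mul_one, hab]
  union A B hA hB hd := by rw [μ.union A B hA hB hd, ν.union A B hA hB hd]; ring
  abs_cont A hA h0 := by rw [μ.abs_cont A hA h0, ν.abs_cont A hA h0]; ring
  not_measurable A hA := by rw [μ.not_measurable A hA, ν.not_measurable A hA]; ring

/-- Convexity of a set of finitely additive probabilities. -/
def IsConvexSet (M : Set (FinAddProb ℓ)) : Prop :=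
  Convex ℝ (toFun '' M)

/-- Convexity of a functional `α : M_{1,f}(ℓ) → (-∞, ∞]` (the values are kept different from
`-∞` separately, so that the sum on the right is never `∞ - ∞`). -/
def IsConvexFunctional (α : FinAddProb ℓ → EReal) : Prop :=
  ∀ (a b : ℝ) (ha : 0 ≤ a) (hb : 0 ≤ b) (hab : a + b = 1) (μ ν : FinAddProb ℓ),
    α (convexComb a b ha hb hab μ ν) ≤ (a : EReal) * α μ + (b : EReal) * α ν

end FinAddProb

namespace RiskMeasure

variable {Ω : Type*} [MeasurableSpace Ω]

/-- The probability space supports a random variable with a continuous distribution. -/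
def IsNonatomic (P : Measure Ω) : Prop :=
  ∃ U : Ω → ℝ, Measurable U ∧ Continuous (cdf (P.map U))

variable {P : Measure Ω}

/-- The upper quantile function `q_X(t) = inf {x | F_X(x) > t}` (for `0 ≤ t < 1`), with
`F_X` the right-continuous distribution function of `X`. -/
def quantileAux (X : Lp ℝ ∞ P) (t : ℝ) : ℝ :=
  sInf {x : ℝ | t < cdf (P.map X) x}

/-- The upper quantile function on `[0, 1]`, with `q_X(1) = q_X(1-)`. -/
def quantile (X : Lp ℝ ∞ P) (t : I) : ℝ :=
  if (t : ℝ) < 1 then quantileAux X t else Function.leftLim (quantileAux X) 1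

/-- Value at risk at level `t ∈ [0, 1]`. -/
def VaR (X : Lp ℝ ∞ P) (t : I) : ℝ :=
  - quantile X t

/-- Monetary risk measures on `L^∞(P)`. The order of `Lp` is the `P`-a.s. order. -/
structure IsMonetary [IsFiniteMeasure P] (ρ : Lp ℝ ∞ P → ℝ) : Prop where
  monotone : ∀ X Y : Lp ℝ ∞ P, X ≤ Y → ρ Y ≤ ρ X
  translation : ∀ (X : Lp ℝ ∞ P) (m : ℝ), ρ (X + Lp.const ∞ P m) = ρ X - m

/-- Law-invariance. -/
def IsLawInvariant (ρ : Lp ℝ ∞ P → ℝ) : Prop :=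
  ∀ X Y : Lp ℝ ∞ P, P.map X = P.map Y → ρ X = ρ Y

/-- Positive homogeneity. -/
def IsPosHomogeneous (ρ : Lp ℝ ∞ P → ℝ) : Prop :=
  ∀ (X : Lp ℝ ∞ P) (a : ℝ), 0 ≤ a → ρ (a • X) = a * ρ X

/-- Two random variables are comonotonic. -/
def Comonotonic (X Y : Lp ℝ ∞ P) : Prop :=
  ∃ Ω₀ : Set Ω, MeasurableSet Ω₀ ∧ P Ω₀ = 1 ∧
    ∀ ω ∈ Ω₀, ∀ ω' ∈ Ω₀, 0 ≤ (X ω - X ω') * (Y ω - Y ω')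

/-- CoM-convex (comonotonic convex) risk measures. -/
structure IsComConvex [IsFiniteMeasure P] (ρ : Lp ℝ ∞ P → ℝ) : Prop extends IsMonetary ρ where
  com_convex : ∀ X Y : Lp ℝ ∞ P, Comonotonic X Y → ∀ a : ℝ, 0 ≤ a → a ≤ 1 →
    ρ (a • X + (1 - a) • Y) ≤ a * ρ X + (1 - a) * ρ Y

/-- CoM-coherent (comonotonic coherent) risk measures. -/
structure IsComCoherent [IsFiniteMeasure P] (ρ : Lp ℝ ∞ P → ℝ) : Prop
    extends IsComConvex ρ where
  pos_hom : IsPosHomogeneous ρ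

end RiskMeasure

end

/-! A nonatomic space carries a uniform variable `U`, and the variables `g(U)` with `g` monotone on
`[0,1]` are pairwise comonotonic. By law-invariance `ρ(X) = ρ(q_X(U))`, so `ρ` is determined by `f ↦
ρ(-f(U))` on antitone `f`, where it is convex, monotone and cash-additive. Duality needs a
functional on a vector space, so this is extended to `L^∞([0,1])` by `hull`: the infimum of
`ρ(g(U))` over monotone `g` with `f ≤ -g` a.e. The extension keeps all three properties
(`convexOn_hull`, `monotone_hull`, `hull_add_const`), and `hull_eq` shows that it takes the value
`ρ(X)` at `f = VaR(X)`.

The rest is duality on `L^∞([0,1])`. A monotone cash-additive functional is 1-Lipschitz, so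
Hahn-Banach gives a subgradient at every point; monotonicity and cash-additivity make it positive
and normalized, hence integration against a finitely additive probability. The penalty is the convex
conjugate of `hull`, and the maximum is attained at a subgradient. In the coherent case subgradients
are dominated by `hull`, and the dominated measures form a closed subset of a compact space. -/

namespace FinAddProb

/-! ### Integration against finitely additive probabilities -/

variable {S : Type*} [MeasurableSpace S] {ℓ : Measure S}

/-- The set function of `μ`, acting on scalars by multiplication. -/
noncomputable def toCLM (μ : FinAddProb ℓ) (A : Set S) : ℝ →L[ℝ] ℝ :=
  μ.toFun A • ContinuousLinearMap.id ℝ ℝ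

/-- Gives access to the general additivity and monotonicity results for
`SimpleFunc.setToSimpleFunc`, which need only finite additivity. -/
theorem simpleIntegral_eq_setToSimpleFunc (μ : FinAddProb ℓ) (s : SimpleFunc S ℝ) :
    μ.simpleIntegral s = s.setToSimpleFunc μ.toCLM := by
  simp [simpleIntegral, SimpleFunc.setToSimpleFunc, toCLM, mul_comm]

theorem finMeasAdditive_toCLM (μ : FinAddProb ℓ) : FinMeasAdditive ℓ μ.toCLM := by
  intro A B hA hB _ _ hd
  simp [toCLM, μ.union A B hA hB hd, add_smul]

theorem toFun_empty (μ : FinAddProb ℓ) : μ.toFun ∅ = 0 :=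
  μ.abs_cont ∅ MeasurableSet.empty measure_empty

theorem toFun_le_one (μ : FinAddProb ℓ) (A : Set S) : μ.toFun A ≤ 1 := by
  by_cases hA : MeasurableSet A
  · have h := μ.union A Aᶜ hA hA.compl disjoint_compl_right
    rw [Set.union_compl_self, μ.univ] at h
    linarith [μ.nonneg Aᶜ]
  · rw [μ.not_measurable A hA]; exact zero_le_one

theorem simpleIntegral_const (μ : FinAddProb ℓ) (c : ℝ) :
    μ.simpleIntegral (SimpleFunc.const S c) = c := by
  rw [simpleIntegral_eq_setToSimpleFunc, SimpleFunc.setToSimpleFunc_const]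
  · simp [toCLM, μ.univ]
  · simp [toCLM, μ.toFun_empty]

theorem ae_abs_le_norm (f : Lp ℝ ∞ ℓ) : ∀ᵐ x ∂ℓ, |f x| ≤ ‖f‖ := by
  filter_upwards [ae_le_eLpNormEssSup (f := f) (μ := ℓ)] with x hx
  rw [Lp.norm_def, eLpNorm_exponent_top, ← Real.norm_eq_abs, ← toReal_enorm]
  refine ENNReal.toReal_mono ?_ hx
  rw [← eLpNorm_exponent_top]
  exact Lp.eLpNorm_ne_top f

theorem integral_congr_ae (μ : FinAddProb ℓ) {f g : S → ℝ} (h : f =ᵐ[ℓ] g) :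
    μ.integral f = μ.integral g := by
  unfold integral
  congr 1
  ext r
  constructor
  · rintro ⟨s, hs, rfl⟩; exact ⟨s, hs.trans h.le, rfl⟩
  · rintro ⟨s, hs, rfl⟩; exact ⟨s, hs.trans h.symm.le, rfl⟩

/-- Round `f` down to a multiple of `ε`. Truncating first at `±‖f‖` changes `f` only on a null set
and makes the range finite everywhere. -/
theorem exists_simpleFunc_le_le_add (f : Lp ℝ ∞ ℓ) {ε : ℝ} (hε : 0 < ε) :
    ∃ s : SimpleFunc S ℝ, ⇑s ≤ᵐ[ℓ] f ∧ f ≤ᵐ[ℓ] ⇑(s + SimpleFunc.const S ε : SimpleFunc S ℝ) := by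
  set n : S → ℤ := fun x => ⌊max (-‖f‖) (min ‖f‖ (f x)) / ε⌋ with hn
  have hm : Measurable n :=
    (((measurable_const.max (measurable_const.min (Lp.stronglyMeasurable f).measurable)).div_const
      ε)).floor
  have hfin : (Set.range n).Finite := by
    refine (Set.finite_Icc ⌊-‖f‖ / ε⌋ ⌊‖f‖ / ε⌋).subset ?_
    rintro _ ⟨x, rfl⟩
    refine ⟨Int.floor_le_floor ?_, Int.floor_le_floor ?_⟩
    · gcongr; exact le_max_left _ _
    · gcongr
      exact max_le (by linarith [norm_nonneg f]) (min_le_left _ _)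
  let s : SimpleFunc S ℝ :=
    ⟨fun x => n x * ε, fun y => by
      have : Measurable fun x => (n x : ℝ) * ε :=
        ((measurable_from_top (f := fun k : ℤ => (k : ℝ))).comp hm).mul_const ε
      exact this (measurableSet_singleton y),
      (hfin.image fun k : ℤ => (k : ℝ) * ε).subset (by rintro _ ⟨x, rfl⟩; exact ⟨n x, ⟨x, rfl⟩, rfl⟩)⟩
  have hb : ∀ᵐ x ∂ℓ, max (-‖f‖) (min ‖f‖ (f x)) = f x := by
    filter_upwards [ae_abs_le_norm f] with x hx
    have := abs_le.1 hx
    rw [min_eq_right this.2, max_eq_right this.1]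
  refine ⟨s, ?_, ?_⟩
  · filter_upwards [hb] with x hx
    have h1 := Int.floor_le (max (-‖f‖) (min ‖f‖ (f x)) / ε)
    rw [le_div_iff₀ hε, hx] at h1
    change (n x : ℝ) * ε ≤ f x
    simpa only [hn, hx] using h1
  · filter_upwards [hb] with x hx
    have h1 := (Int.lt_floor_add_one (max (-‖f‖) (min ‖f‖ (f x)) / ε)).le
    rw [div_le_iff₀ hε, hx] at h1
    change f x ≤ (n x : ℝ) * ε + ε
    simp only [hn, hx]
    linarith

theorem simpleIntegral_convexComb {a b : ℝ} (ha : 0 ≤ a) (hb : 0 ≤ b) (hab : a + b = 1)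
    (μ ν : FinAddProb ℓ) (s : SimpleFunc S ℝ) :
    (convexComb a b ha hb hab μ ν).simpleIntegral s =
      a * μ.simpleIntegral s + b * ν.simpleIntegral s := by
  simp only [simpleIntegral, convexComb, Finset.mul_sum, ← Finset.sum_add_distrib]
  exact Finset.sum_congr rfl fun _ _ => by ring

theorem continuous_integral (f : Lp ℝ ∞ ℓ) : Continuous fun μ : FinAddProb ℓ => μ.integral f :=
  continuous_iInf_dom continuous_induced_dom

variable [IsFiniteMeasure ℓ]

theorem simpleIntegral_add (μ : FinAddProb ℓ) (s t : SimpleFunc S ℝ) :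
    μ.simpleIntegral (s + t) = μ.simpleIntegral s + μ.simpleIntegral t := by
  simp only [simpleIntegral_eq_setToSimpleFunc]
  exact SimpleFunc.setToSimpleFunc_add _ μ.finMeasAdditive_toCLM
    (SimpleFunc.integrable_of_isFiniteMeasure s) (SimpleFunc.integrable_of_isFiniteMeasure t)

theorem simpleIntegral_mono_ae (μ : FinAddProb ℓ) {s t : SimpleFunc S ℝ} (h : ⇑s ≤ᵐ[ℓ] ⇑t) :
    μ.simpleIntegral s ≤ μ.simpleIntegral t := by
  -- Replacing `t` by `s ⊔ t`, equal to it a.e., turns the a.e. inequality into one that holds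
  -- everywhere.
  have h₁ : s ≤ s ⊔ t := le_sup_left
  have h₂ : ⇑(s ⊔ t) =ᵐ[ℓ] ⇑t := by
    filter_upwards [h] with x hx
    simpa using hx
  simp only [simpleIntegral_eq_setToSimpleFunc]
  rw [← SimpleFunc.setToSimpleFunc_congr _ (fun A hA h0 => ?_) μ.finMeasAdditive_toCLM
    (SimpleFunc.integrable_of_isFiniteMeasure _) h₂]
  · refine SimpleFunc.setToSimpleFunc_mono μ.finMeasAdditive_toCLM (fun A _ _ x hx => ?_)
      (SimpleFunc.integrable_of_isFiniteMeasure _) (SimpleFunc.integrable_of_isFiniteMeasure _) h₁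
    simpa [toCLM] using mul_nonneg (μ.nonneg A) hx
  · simp [toCLM, μ.abs_cont A hA h0]

theorem simpleIntegral_mem_Icc (μ : FinAddProb ℓ) {s t : SimpleFunc S ℝ} {f : S → ℝ}
    (hs : ⇑s ≤ᵐ[ℓ] f) (ht : f ≤ᵐ[ℓ] ⇑t) :
    μ.integral f ∈ Set.Icc (μ.simpleIntegral s) (μ.simpleIntegral t) := by
  have hub : ∀ r ∈ {r : ℝ | ∃ s : SimpleFunc S ℝ, (⇑s ≤ᵐ[ℓ] f) ∧ r = μ.simpleIntegral s},
      r ≤ μ.simpleIntegral t := by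
    rintro r ⟨u, hu, rfl⟩
    exact μ.simpleIntegral_mono_ae (hu.trans ht)
  exact ⟨le_csSup ⟨_, hub⟩ ⟨s, hs, rfl⟩, csSup_le ⟨_, s, hs, rfl⟩ hub⟩

/-- The same simple function serves every `μ`; this uniformity is what the compactness proof needs.
-/
theorem exists_simpleIntegral_approx (f : Lp ℝ ∞ ℓ) {ε : ℝ} (hε : 0 < ε) :
    ∃ s : SimpleFunc S ℝ, ⇑s ≤ᵐ[ℓ] f ∧ f ≤ᵐ[ℓ] ⇑(s + SimpleFunc.const S ε : SimpleFunc S ℝ) ∧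
      ∀ μ : FinAddProb ℓ, |μ.integral f - μ.simpleIntegral s| ≤ ε := by
  obtain ⟨s, h₁, h₂⟩ := exists_simpleFunc_le_le_add f hε
  refine ⟨s, h₁, h₂, fun μ => ?_⟩
  obtain ⟨h₃, h₄⟩ := μ.simpleIntegral_mem_Icc h₁ h₂
  rw [simpleIntegral_add, simpleIntegral_const] at h₄
  exact abs_le.2 ⟨by linarith, by linarith⟩

/-- Sandwiching simple functions determine the integral, so identities for it can be checked without
manipulating the supremum that defines it. -/
theorem integral_eq_of_simpleIntegral {μ : FinAddProb ℓ} {f : Lp ℝ ∞ ℓ} {r : ℝ}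
    (hr : ∀ s : SimpleFunc S ℝ, ∀ ε > 0, ⇑s ≤ᵐ[ℓ] f → f ≤ᵐ[ℓ] ⇑(s + SimpleFunc.const S ε : SimpleFunc S ℝ) →
      |r - μ.simpleIntegral s| ≤ ε) : μ.integral f = r := by
  refine eq_of_forall_dist_le fun ε hε => ?_
  obtain ⟨s, h₁, h₂, h₃⟩ := exists_simpleIntegral_approx f (half_pos hε)
  have h₄ := abs_le.1 (hr s _ (half_pos hε) h₁ h₂)
  have h₅ := abs_le.1 (h₃ μ)
  rw [Real.dist_eq]
  exact abs_le.2 ⟨by linarith, by linarith⟩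

theorem integral_convexComb {a b : ℝ} (ha : 0 ≤ a) (hb : 0 ≤ b) (hab : a + b = 1)
    (μ ν : FinAddProb ℓ) (f : Lp ℝ ∞ ℓ) :
    (convexComb a b ha hb hab μ ν).integral f = a * μ.integral f + b * ν.integral f := by
  refine integral_eq_of_simpleIntegral fun s ε hε h₁ h₂ => ?_
  rw [simpleIntegral_convexComb]
  have hμ := μ.simpleIntegral_mem_Icc h₁ h₂
  have hν := ν.simpleIntegral_mem_Icc h₁ h₂
  simp only [simpleIntegral_add, simpleIntegral_const, Set.mem_Icc] at hμ hν
  have h₃ := mul_le_mul_of_nonneg_left hμ.1 ha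
  have h₄ := mul_le_mul_of_nonneg_left hμ.2 ha
  have h₅ := mul_le_mul_of_nonneg_left hν.1 hb
  have h₆ := mul_le_mul_of_nonneg_left hν.2 hb
  have h₇ : a * ε + b * ε = ε := by rw [← add_mul, hab, one_mul]
  exact abs_le.2 ⟨by linarith, by linarith⟩

/-- Along an ultrafilter the values on each set converge in `[0,1]`, and the axioms of `FinAddProb`
pass to the setwise limit `ν`. Convergence of simple integrals extends to all of `L^∞` by uniform
approximation. -/
instance : CompactSpace (FinAddProb ℓ) := by
  refine ⟨isCompact_iff_ultrafilter_le_nhds.2 fun F _ => ?_⟩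
  have hlim : ∀ A : Set S, ∃ c : ℝ,
      Filter.Tendsto (fun μ : FinAddProb ℓ => μ.toFun A) F (𝓝 c) := fun A => by
    obtain ⟨c, -, hc⟩ := isCompact_iff_ultrafilter_le_nhds.1 (isCompact_Icc (a := (0 : ℝ)) (b := 1))
      (F.map fun μ : FinAddProb ℓ => μ.toFun A)
      (Filter.le_principal_iff.2 (Filter.mem_map.2
        (Filter.Eventually.of_forall fun μ : FinAddProb ℓ => ⟨μ.nonneg A, μ.toFun_le_one A⟩)))
    exact ⟨c, hc⟩
  choose c hc using hlim
  let ν : FinAddProb ℓ :=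
    { toFun := c
      nonneg := fun A => ge_of_tendsto' (hc A) fun μ => μ.nonneg A
      univ := tendsto_nhds_unique (hc _) (by simp only [FinAddProb.univ]; exact tendsto_const_nhds)
      union := fun A B hA hB hd => tendsto_nhds_unique (hc _) (by
        simp only [FinAddProb.union _ A B hA hB hd]; exact (hc A).add (hc B))
      abs_cont := fun A hA h0 => tendsto_nhds_unique (hc _) (by
        simp only [FinAddProb.abs_cont _ A hA h0]; exact tendsto_const_nhds)
      not_measurable := fun A hA => tendsto_nhds_unique (hc _) (by
        simp only [FinAddProb.not_measurable _ A hA]; exact tendsto_const_nhds) }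
  refine ⟨ν, Set.mem_univ _, ?_⟩
  rw [nhds_iInf]
  refine le_iInf fun f => ?_
  rw [nhds_induced, ← Filter.tendsto_iff_comap]
  have hs : ∀ s : SimpleFunc S ℝ, Filter.Tendsto (fun μ : FinAddProb ℓ => μ.simpleIntegral s) F
      (𝓝 (ν.simpleIntegral s)) := fun s =>
    tendsto_finsetSum _ fun y _ => (hc (s ⁻¹' {y})).const_mul y
  rw [Metric.tendsto_nhds]
  intro ε hε
  -- Two approximation errors and one convergence error, each at most `ε / 4`.
  obtain ⟨s, -, -, h⟩ := exists_simpleIntegral_approx f (by positivity : 0 < ε / 4)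
  filter_upwards [Metric.tendsto_nhds.1 (hs s) (ε / 4) (by positivity)] with μ hμ
  rw [Real.dist_eq] at hμ ⊢
  have h₁ := abs_le.1 (h μ)
  have h₂ := abs_le.1 (h ν)
  have h₃ := abs_lt.1 hμ
  exact abs_lt.2 ⟨by linarith, by linarith⟩

/-- The finitely additive probability `A ↦ L 1_A` of a positive normalized functional `L`. -/
noncomputable def ofPositive (L : Lp ℝ ∞ ℓ →ₗ[ℝ] ℝ) (hpos : ∀ f, 0 ≤ f → 0 ≤ L f)
    (hone : L (Lp.const ∞ ℓ 1) = 1) : FinAddProb ℓ := by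
  classical
  exact
  { toFun := fun A =>
      if hA : MeasurableSet A then L (indicatorConstLp ∞ hA (measure_ne_top ℓ A) 1) else 0
    nonneg := fun A => by
      split_ifs with hA
      · refine hpos _ ((Lp.coeFn_le _ _).1 ?_)
        filter_upwards [Lp.coeFn_zero ℝ ∞ ℓ,
          indicatorConstLp_coeFn (p := ∞) (hs := hA) (hμs := measure_ne_top ℓ A) (c := (1 : ℝ))]
          with x h₁ h₂
        rw [h₁, h₂]
        exact Set.indicator_nonneg (fun _ _ => zero_le_one) x
      · exact le_rfl
    univ := by
      rw [dif_pos MeasurableSet.univ, indicatorConstLp_univ, hone]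
    union := fun A B hA hB hd => by
      rw [dif_pos hA, dif_pos hB, dif_pos (hA.union hB), ← map_add,
        indicatorConstLp_disjoint_union hA hB (measure_ne_top ℓ A) (measure_ne_top ℓ B) hd]
    abs_cont := fun A hA h0 => by
      rw [dif_pos hA, ← map_zero L]
      congr 1
      refine Lp.ext ?_
      filter_upwards [Lp.coeFn_zero ℝ ∞ ℓ,
          indicatorConstLp_coeFn (p := ∞) (hs := hA) (hμs := measure_ne_top ℓ A) (c := (1 : ℝ)),
          measure_eq_zero_iff_ae_notMem.1 h0] with x h₁ h₂ h₃
      rw [h₁, h₂, Set.indicator_of_notMem h₃]; rfl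
    not_measurable := fun A hA => dif_neg hA }

/-- Positivity makes `L` monotone, so `s ≤ f ≤ s + ε` a.e. bounds `L f` between `L s` and `L s + ε`.
-/
theorem integral_ofPositive (L : Lp ℝ ∞ ℓ →ₗ[ℝ] ℝ) (hpos : ∀ f, 0 ≤ f → 0 ≤ L f)
    (hone : L (Lp.const ∞ ℓ 1) = 1) (f : Lp ℝ ∞ ℓ) :
    (ofPositive L hpos hone).integral f = L f := by
  have hmono : ∀ f g : Lp ℝ ∞ ℓ, f ≤ g → L f ≤ L g := fun f g hfg => by
    have := hpos (g - f) (sub_nonneg.2 hfg)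
    rw [map_sub] at this
    linarith
  have hconst : ∀ c : ℝ, L (Lp.const ∞ ℓ c) = c := fun c => by
    have h : Lp.const ∞ ℓ c = c • Lp.const ∞ ℓ (1 : ℝ) := by
      rw [← Lp.constₗ_apply ∞ ℓ ℝ, ← Lp.constₗ_apply ∞ ℓ ℝ, ← map_smul]; simp
    rw [h, map_smul, hone]; simp
  refine integral_eq_of_simpleIntegral fun s ε hε h₁ h₂ => ?_
  -- The class of `s`, written as a combination of indicators so that linearity computes `L g`.
  let g : Lp ℝ ∞ ℓ := ∑ y ∈ s.range,
    y • indicatorConstLp ∞ (s.measurableSet_fiber y) (measure_ne_top ℓ (s ⁻¹' {y})) (1 : ℝ)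
  have hg : g =ᵐ[ℓ] ⇑s := by
    have h : ∀ᵐ x ∂ℓ, ∀ y ∈ s.range,
        (y • indicatorConstLp ∞ (s.measurableSet_fiber y) (measure_ne_top ℓ (s ⁻¹' {y})) (1 : ℝ) :
          Lp ℝ ∞ ℓ) x = (s ⁻¹' {y}).indicator (fun _ => y) x := by
      rw [Filter.eventually_all_finset]
      intro y _
      filter_upwards [Lp.coeFn_smul y (indicatorConstLp ∞ (s.measurableSet_fiber y)
        (measure_ne_top ℓ (s ⁻¹' {y})) (1 : ℝ)), indicatorConstLp_coeFn (p := ∞)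
        (hs := s.measurableSet_fiber y) (hμs := measure_ne_top ℓ (s ⁻¹' {y})) (c := (1 : ℝ))]
        with x h₁ h₂
      rw [h₁, Pi.smul_apply, h₂]
      by_cases hx : x ∈ s ⁻¹' {y} <;> simp [hx]
    filter_upwards [h, Lp.coeFn_finsetSum s.range (fun y => (y • indicatorConstLp ∞
      (s.measurableSet_fiber y) (measure_ne_top ℓ (s ⁻¹' {y})) (1 : ℝ) : Lp ℝ ∞ ℓ))] with x h₁ h₂
    rw [h₂, Finset.sum_apply, Finset.sum_congr rfl h₁, Finset.sum_eq_single (s x)]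
    · simp
    · intro y _ hy
      exact Set.indicator_of_notMem (fun h => hy h.symm) _
    · intro h
      exact absurd (s.mem_range_self x) h
  have hLg : L g = (ofPositive L hpos hone).simpleIntegral s := by
    simp only [g, map_sum, map_smul, simpleIntegral, smul_eq_mul]
    refine Finset.sum_congr rfl fun y _ => ?_
    rw [ofPositive]
    simp only [dif_pos (s.measurableSet_fiber y)]
  rw [← hLg]
  have h₃ : L g ≤ L f := hmono _ _ ((Lp.coeFn_le _ _).1 (hg.le.trans h₁))
  have h₄ : L f ≤ L (g + Lp.const ∞ ℓ ε) := by
    refine hmono _ _ ((Lp.coeFn_le _ _).1 ?_)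
    filter_upwards [h₂, hg, Lp.coeFn_add g (Lp.const ∞ ℓ ε), Lp.coeFn_const ∞ ℓ ε] with x a b c d
    rw [c, Pi.add_apply, b, d]
    exact a
  rw [map_add, hconst] at h₄
  exact abs_le.2 ⟨by linarith, by linarith⟩

end FinAddProb

/-! ### Subgradients and dual representation of convex functionals -/

/-- Separate `(x, p x)` from the strict epigraph, which is open because `p` is continuous. The
separating hyperplane is not vertical, since `(x, p x + 1)` lies strictly on one side, so it is the
graph of an affine minorant touching `p` at `x`. -/
theorem ConvexOn.exists_subgradient {E : Type*} [TopologicalSpace E] [AddCommGroup E] [Module ℝ E]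
    [IsTopologicalAddGroup E] [ContinuousSMul ℝ E] {p : E → ℝ} (hp : ConvexOn ℝ Set.univ p)
    (hcont : Continuous p) (x : E) : ∃ L : E →L[ℝ] ℝ, ∀ y, L y - L x ≤ p y - p x := by
  have hopen : IsOpen {z : E × ℝ | z.1 ∈ Set.univ ∧ p z.1 < z.2} := by
    simpa using isOpen_lt (hcont.comp continuous_fst) continuous_snd
  obtain ⟨G, hG⟩ := geometric_hahn_banach_point_open (x := (x, p x)) hp.convex_strict_epigraph
    hopen (by simp)
  have hsplit : ∀ y r, G (y, r) = G (y, 0) + r * G (0, 1) := fun y r => by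
    have h : ((y, r) : E × ℝ) = (y, 0) + r • (0, 1) := by simp
    rw [h, map_add, map_smul, smul_eq_mul]
  have hc : 0 < G (0, 1) := by
    have h := hG (x, p x + 1) (by simp)
    rw [hsplit, hsplit x (p x + 1)] at h
    linarith
  -- Points of the graph are limits of points of the strict epigraph, so the inequality survives
  -- with `≤`.
  have hle : ∀ y, G (x, 0) + p x * G (0, 1) ≤ G (y, 0) + p y * G (0, 1) := fun y => by
    refine le_of_forall_pos_le_add fun ε hε => ?_
    have h := hG (y, p y + ε / G (0, 1)) (by simpa using div_pos hε hc)
    rw [hsplit, hsplit y, add_mul, div_mul_cancel₀ _ hc.ne'] at h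
    linarith
  refine ⟨-(G (0, 1))⁻¹ • G.comp (ContinuousLinearMap.inl ℝ E ℝ), fun y => ?_⟩
  have h := mul_le_mul_of_nonneg_left (hle y) (inv_pos.2 hc).le
  have h₁ : ∀ r, (G (0, 1))⁻¹ * (r * G (0, 1)) = r := fun r => by field_simp
  rw [mul_add, mul_add, h₁, h₁] at h
  simp
  linarith

namespace FinAddProb

variable {S : Type*} [MeasurableSpace S] {ℓ : Measure S} [IsFiniteMeasure ℓ]

/-- From `f ≤ g + ‖f - g‖` a.e. the functional is 1-Lipschitz. -/
theorem continuous_of_monotone_translation {p : Lp ℝ ∞ ℓ → ℝ} (hmono : Monotone p)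
    (htrans : ∀ f (m : ℝ), p (f + Lp.const ∞ ℓ m) = p f + m) : Continuous p := by
  have h : ∀ f g : Lp ℝ ∞ ℓ, p f - p g ≤ ‖f - g‖ := fun f g => by
    have h₁ : f ≤ g + Lp.const ∞ ℓ ‖f - g‖ := by
      refine (Lp.coeFn_le _ _).1 ?_
      filter_upwards [ae_abs_le_norm (f - g), Lp.coeFn_sub f g,
        Lp.coeFn_add g (Lp.const ∞ ℓ ‖f - g‖), Lp.coeFn_const ∞ ℓ ‖f - g‖] with x a b c d
      rw [c, Pi.add_apply, d]
      rw [b] at a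
      have := (abs_le.1 a).2
      simp only [Pi.sub_apply, Function.const_apply] at this ⊢
      linarith
    have h₂ := hmono h₁
    rw [htrans] at h₂
    linarith
  refine (LipschitzWith.of_dist_le_mul (K := 1) fun f g => ?_).continuous
  rw [Real.dist_eq, dist_eq_norm, NNReal.coe_one, one_mul]
  refine abs_le.2 ⟨?_, h f g⟩
  have := h g f
  rw [norm_sub_rev] at this
  linarith

theorem exists_subgradient {p : Lp ℝ ∞ ℓ → ℝ} (hconv : ConvexOn ℝ Set.univ p)
    (hmono : Monotone p) (htrans : ∀ f (m : ℝ), p (f + Lp.const ∞ ℓ m) = p f + m)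
    (f : Lp ℝ ∞ ℓ) :
    ∃ (L : Lp ℝ ∞ ℓ →L[ℝ] ℝ) (μ : FinAddProb ℓ), (∀ g : Lp ℝ ∞ ℓ, μ.integral g = L g) ∧
      ∀ g, L g - L f ≤ p g - p f := by
  obtain ⟨L, hL⟩ := hconv.exists_subgradient (continuous_of_monotone_translation hmono htrans) f
  -- Testing the subgradient at `f - g` gives positivity; testing it at `f + 1` and `f - 1` gives `L
  -- 1 = 1`.
  have hpos : ∀ g, 0 ≤ g → 0 ≤ L g := fun g hg => by
    have h₁ := hL (f - g)
    have h₂ := hmono (sub_le_self f hg)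
    rw [map_sub] at h₁
    linarith
  have hone : L (Lp.const ∞ ℓ 1) = 1 := by
    have h₁ := hL (f + Lp.const ∞ ℓ 1)
    have h₂ := hL (f + Lp.const ∞ ℓ (-1))
    rw [htrans, map_add] at h₁ h₂
    rw [map_neg (Lp.const ∞ ℓ), map_neg] at h₂
    linarith
  exact ⟨L, ofPositive L.toLinearMap hpos hone, integral_ofPositive L.toLinearMap hpos hone, hL⟩

/-- The penalty is the conjugate `sup_f (∫ f dμ - p f)`: a supremum of continuous affine functions
of `μ`, hence lower semicontinuous and convex. At a subgradient of `p` at `f` the supremum is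
reached at `f` itself, which gives attainment. -/
theorem exists_penalty {p : Lp ℝ ∞ ℓ → ℝ} (hconv : ConvexOn ℝ Set.univ p)
    (hmono : Monotone p) (htrans : ∀ f (m : ℝ), p (f + Lp.const ∞ ℓ m) = p f + m) :
    ∃ α : FinAddProb ℓ → EReal, (∀ μ, α μ ≠ ⊥) ∧ LowerSemicontinuous α ∧
      IsConvexFunctional α ∧ ∀ f : Lp ℝ ∞ ℓ, IsGreatest
        (Set.range fun μ : FinAddProb ℓ => ((μ.integral f : ℝ) : EReal) - α μ) (p f : EReal) := by
  have hle : ∀ (μ : FinAddProb ℓ) (f : Lp ℝ ∞ ℓ), ((μ.integral f - p f : ℝ) : EReal) ≤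
      ⨆ g : Lp ℝ ∞ ℓ, ((μ.integral g - p g : ℝ) : EReal) :=
    fun μ f => le_iSup (fun g : Lp ℝ ∞ ℓ => ((μ.integral g - p g : ℝ) : EReal)) f
  refine ⟨fun μ => ⨆ f : Lp ℝ ∞ ℓ, ((μ.integral f - p f : ℝ) : EReal), fun μ h => ?_, ?_, ?_,
    fun f => ⟨?_, ?_⟩⟩
  · exact EReal.coe_ne_bot _ (le_bot_iff.1 ((hle μ 0).trans h.le))
  · exact lowerSemicontinuous_iSup fun f => (continuous_coe_real_ereal.comp
      ((continuous_integral f).sub continuous_const)).lowerSemicontinuous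
  · intro a b ha hb hab μ ν
    refine iSup_le fun f => ?_
    have h : (convexComb a b ha hb hab μ ν).integral f - p f =
        a * (μ.integral f - p f) + b * (ν.integral f - p f) := by
      rw [integral_convexComb]
      linear_combination (p f) * hab
    rw [h, EReal.coe_add, EReal.coe_mul, EReal.coe_mul]
    exact add_le_add (mul_le_mul_of_nonneg_left (hle μ f) (EReal.coe_nonneg.2 ha))
      (mul_le_mul_of_nonneg_left (hle ν f) (EReal.coe_nonneg.2 hb))
  · obtain ⟨L, μ, hμL, hL⟩ := exists_subgradient hconv hmono htrans f
    refine ⟨μ, ?_⟩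
    have h : ⨆ g : Lp ℝ ∞ ℓ, ((μ.integral g - p g : ℝ) : EReal) =
        ((μ.integral f - p f : ℝ) : EReal) :=
      le_antisymm (iSup_le fun g => EReal.coe_le_coe_iff.2 (by linarith [hL g, hμL f, hμL g])) (hle μ f)
    simp only [h, ← EReal.coe_sub, sub_sub_cancel]
  · rintro _ ⟨μ, rfl⟩
    refine (EReal.sub_le_sub le_rfl (hle μ f)).trans ?_
    rw [← EReal.coe_sub, sub_sub_cancel]

theorem exists_isCompact_representation {p : Lp ℝ ∞ ℓ → ℝ} (hconv : ConvexOn ℝ Set.univ p)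
    (hmono : Monotone p) (htrans : ∀ f (m : ℝ), p (f + Lp.const ∞ ℓ m) = p f + m)
    (hhom : ∀ f (a : ℝ), 0 < a → p (a • f) = a * p f) :
    ∃ M : Set (FinAddProb ℓ), M.Nonempty ∧ IsCompact M ∧ IsConvexSet M ∧
      ∀ f : Lp ℝ ∞ ℓ, IsGreatest ((fun μ : FinAddProb ℓ => μ.integral f) '' M) (p f) := by
  have hzero : p 0 = 0 := by
    have := hhom 0 2 two_pos
    rw [smul_zero] at this
    linarith
  have hmem : ∀ f : Lp ℝ ∞ ℓ, ∃ μ : FinAddProb ℓ, (∀ g : Lp ℝ ∞ ℓ, μ.integral g ≤ p g) ∧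
      μ.integral f = p f := fun f => by
    obtain ⟨L, μ, hμL, hL⟩ := exists_subgradient hconv hmono htrans f
    -- By homogeneity the test points `2f` and `0` give `L f ≤ p f` and `L f ≥ p f`; the subgradient
    -- inequality then reads `L ≤ p`.
    have h₁ := hL ((2 : ℝ) • f)
    have h₂ := hL 0
    rw [hhom f 2 two_pos, map_smul, smul_eq_mul] at h₁
    rw [map_zero, hzero] at h₂
    exact ⟨μ, fun g => by linarith [hL g, hμL g], by linarith [hμL f]⟩
  refine ⟨{μ | ∀ f : Lp ℝ ∞ ℓ, μ.integral f ≤ p f}, ?_, ?_, ?_, fun f => ⟨?_, ?_⟩⟩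
  · obtain ⟨μ, hμ, -⟩ := hmem 0
    exact ⟨μ, hμ⟩
  · rw [Set.ofPred_forall]
    exact (isClosed_iInter fun f =>
      isClosed_le (continuous_integral f) continuous_const).isCompact
  · rintro _ ⟨μ, hμ, rfl⟩ _ ⟨ν, hν, rfl⟩ a b ha hb hab
    refine ⟨convexComb a b ha hb hab μ ν, fun f => ?_, rfl⟩
    rw [integral_convexComb]
    have h₁ := mul_le_mul_of_nonneg_left (hμ f) ha
    have h₂ := mul_le_mul_of_nonneg_left (hν f) hb
    have h₃ : a * p f + b * p f = p f := by rw [← add_mul, hab, one_mul]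
    linarith
  · obtain ⟨μ, hμ, h⟩ := hmem f
    exact ⟨μ, hμ, h⟩
  · rintro _ ⟨μ, hμ, rfl⟩
    exact hμ f

end FinAddProb

/-! ### Uniform variables and quantiles -/

/-- Probability integral transform `U = F(V)`: continuity of `F` makes every level in `(0,1)` a
value `F c`, and events of `U` are compared with `{V ≤ c}`. -/
theorem MeasureTheory.exists_map_eq_volume_unitInterval {Ω : Type*} [MeasurableSpace Ω]
    {P : Measure Ω} [IsProbabilityMeasure P] (hP : RiskMeasure.IsNonatomic P) :
    ∃ U : Ω → I, Measurable U ∧ P.map U = volume := by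
  obtain ⟨V, hV, hF⟩ := hP
  have : IsProbabilityMeasure (P.map V) := Measure.isProbabilityMeasure_map hV.aemeasurable
  set F := cdf (P.map V) with hFdef
  have hFV : ∀ c, P.real (V ⁻¹' Set.Iic c) = F c := fun c => by
    rw [hFdef, cdf_eq_real, map_measureReal_apply hV measurableSet_Iic]
  have hex : ∀ u, 0 < u → u < 1 → ∃ c, F c = u := fun u h0 h1 =>
    mem_range_of_exists_le_of_exists_ge hF
      (((tendsto_cdf_atBot _).eventually_lt_const h0).exists.imp fun _ h => h.le)
      (((tendsto_cdf_atTop _).eventually_const_lt h1).exists.imp fun _ h => h.le)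
  let U : Ω → I := fun ω => ⟨F (V ω), cdf_nonneg _ _, cdf_le_one _ _⟩
  have hU : Measurable U := (hF.measurable.comp hV).subtype_mk
  refine ⟨U, hU, ?_⟩
  have : IsProbabilityMeasure (P.map U) := Measure.isProbabilityMeasure_map hU.aemeasurable
  refine Measure.ext_of_Iic _ _ fun u => ?_
  rw [unitInterval.volume_Iic, Measure.map_apply hU measurableSet_Iic, ← ofReal_measureReal]
  congr 1
  refine le_antisymm (le_of_not_gt fun hlt => ?_) ?_
  -- For `F c = u' > u`, the event `{U ≤ u}` lies in `{V ≤ c}`, of probability `u'`, contradicting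
  -- the choice of `u'`.
  · obtain ⟨u', h₁, h₂⟩ := exists_between hlt
    obtain ⟨c, hc⟩ := hex u' (u.2.1.trans_lt h₁) (h₂.trans_le measureReal_le_one)
    refine absurd h₂ (not_lt.2 ?_)
    rw [← hc, ← hFV]
    refine measureReal_mono fun ω hω => show V ω ≤ c from le_of_not_gt fun h => ?_
    have h₃ : F (V ω) ≤ u := hω
    have h₄ : F c ≤ F (V ω) := monotone_cdf _ (le_of_lt h)
    linarith
  · rcases u.2.1.eq_or_lt with h0 | h0
    · rw [← h0]; exact measureReal_nonneg
    rcases u.2.2.eq_or_lt with h1 | h1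
    · have : U ⁻¹' Set.Iic u = Set.univ :=
        Set.eq_univ_of_forall fun ω => Subtype.coe_le_coe.1 ((U ω).2.2.trans h1.ge)
      rw [this, probReal_univ, h1]
    · obtain ⟨c, hc⟩ := hex u h0 h1
      rw [← hc, ← hFV]
      refine measureReal_mono fun ω hω => ?_
      have h₄ : F (V ω) ≤ F c := monotone_cdf _ hω
      exact h₄.trans hc.le

namespace RiskMeasure

variable {Ω : Type*} [MeasurableSpace Ω] {P : Measure Ω}

/-- A version of the quantile function that is monotone on the whole of `[0, 1]`. -/
noncomputable def monotoneQuantile (X : Lp ℝ ∞ P) (t : I) : ℝ :=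
  if (t : ℝ) < 1 then quantileAux X t else ‖X‖

/-- The value at `1` is irrelevant to the integrals, so the upper bound `‖X‖` can stand in for the
left limit. -/
theorem monotoneQuantile_ae_eq (X : Lp ℝ ∞ P) :
    monotoneQuantile X =ᵐ[(volume : Measure I)] quantile X := by
  have h : ∀ᵐ t ∂(volume : Measure I), t ∉ ({1} : Set I) :=
    measure_eq_zero_iff_ae_notMem.1 (measure_singleton _)
  filter_upwards [h] with t ht
  have ht : (t : ℝ) < 1 := lt_of_le_of_ne t.2.2 fun h => ht (Subtype.ext h)
  simp [monotoneQuantile, quantile, ht]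

variable [IsProbabilityMeasure P]

instance (X : Lp ℝ ∞ P) : IsProbabilityMeasure (P.map X) :=
  Measure.isProbabilityMeasure_map (Lp.stronglyMeasurable X).measurable.aemeasurable

theorem cdf_norm (X : Lp ℝ ∞ P) : cdf (P.map X) ‖X‖ = 1 := by
  rw [cdf_eq_real, map_measureReal_apply (Lp.stronglyMeasurable X).measurable measurableSet_Iic,
    ← probReal_univ (μ := P)]
  refine measureReal_congr ?_
  filter_upwards [FinAddProb.ae_abs_le_norm X] with ω hω
  exact eq_true ((abs_le.1 hω).2)

theorem cdf_eq_zero (X : Lp ℝ ∞ P) {x : ℝ} (hx : x < -‖X‖) : cdf (P.map X) x = 0 := by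
  rw [cdf_eq_real, map_measureReal_apply (Lp.stronglyMeasurable X).measurable measurableSet_Iic,
    ← measureReal_empty (μ := P)]
  refine measureReal_congr ?_
  filter_upwards [FinAddProb.ae_abs_le_norm X] with ω hω
  refine eq_false fun h => ?_
  have h₁ : X ω ≤ x := h
  linarith [(abs_le.1 hω).1]

theorem bddBelow_quantileAux (X : Lp ℝ ∞ P) {t : ℝ} (ht : 0 ≤ t) :
    BddBelow {x : ℝ | t < cdf (P.map X) x} :=
  ⟨-‖X‖, fun x hx => le_of_not_gt fun h => by
    have h₁ : t < cdf (P.map X) x := hx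
    rw [cdf_eq_zero X h] at h₁
    linarith⟩

theorem norm_mem_quantileAux (X : Lp ℝ ∞ P) {t : ℝ} (ht : t < 1) :
    ‖X‖ ∈ {x : ℝ | t < cdf (P.map X) x} := by
  simpa [cdf_norm X] using ht

theorem monotone_monotoneQuantile (X : Lp ℝ ∞ P) : Monotone (monotoneQuantile X) := by
  intro s t hst
  have hst' : (s : ℝ) ≤ t := hst
  unfold monotoneQuantile
  by_cases ht : (t : ℝ) < 1
  · rw [if_pos ht, if_pos (hst'.trans_lt ht)]
    exact csInf_le_csInf (bddBelow_quantileAux X s.2.1) ⟨_, norm_mem_quantileAux X ht⟩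
      fun x hx => hst'.trans_lt hx
  · rw [if_neg ht]
    split_ifs with hs
    · exact csInf_le (bddBelow_quantileAux X s.2.1) (norm_mem_quantileAux X hs)
    · exact le_rfl

/-- The set where the quantile is at most `x` lies between `[0, F(x))` and `[0, F(x)] ∪ {1}`, both
of measure `F(x)`. The upper inclusion uses right-continuity of `F`. -/
theorem map_monotoneQuantile (X : Lp ℝ ∞ P) :
    (volume : Measure I).map (monotoneQuantile X) = P.map X := by
  have hm := (monotone_monotoneQuantile X).measurable
  have : IsProbabilityMeasure ((volume : Measure I).map (monotoneQuantile X)) :=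
    Measure.isProbabilityMeasure_map hm.aemeasurable
  refine Measure.ext_of_Iic _ _ fun x => ?_
  rw [← ofReal_cdf (P.map X), Measure.map_apply hm measurableSet_Iic]
  let c : I := ⟨cdf (P.map X) x, cdf_nonneg _ _, cdf_le_one _ _⟩
  refine le_antisymm ?_ ?_
  · have hsub : monotoneQuantile X ⁻¹' Set.Iic x ⊆ Set.Iic c ∪ {1} := by
      intro t ht
      by_cases ht1 : (t : ℝ) < 1
      · left
        have hq : quantileAux X t ≤ x := by simpa [monotoneQuantile, ht1] using ht
        have hlt : ∀ y, x < y → (t : ℝ) ≤ cdf (P.map X) y := fun y hy => by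
          obtain ⟨z, hz, hzy⟩ := exists_lt_of_csInf_lt ⟨_, norm_mem_quantileAux X ht1⟩
            (hq.trans_lt hy)
          exact (le_of_lt hz).trans (monotone_cdf _ hzy.le)
        have hlim := ((cdf (P.map X)).right_continuous x).tendsto.mono_left
          (nhdsWithin_mono x Set.Ioi_subset_Ici_self)
        exact ge_of_tendsto hlim (eventually_nhdsWithin_of_forall hlt)
      · right
        exact Subtype.ext (le_antisymm t.2.2 (not_lt.1 ht1))
    refine (measure_mono hsub).trans ((measure_union_le _ _).trans ?_)
    rw [unitInterval.volume_Iic, measure_singleton, add_zero]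
  · rw [show ENNReal.ofReal (cdf (P.map X) x) = volume (Set.Iio c) from
      (unitInterval.volume_Iio c).symm]
    refine measure_mono fun t ht => ?_
    have ht' : (t : ℝ) < cdf (P.map X) x := ht
    have ht1 : (t : ℝ) < 1 := ht'.trans_le (cdf_le_one _ _)
    simp only [Set.mem_preimage, Set.mem_Iic, monotoneQuantile, if_pos ht1]
    exact csInf_le (bddBelow_quantileAux X t.2.1) ht'

end RiskMeasure

/-! ### The comonotone family `g(U)` and the extension of `ρ` to `L^∞([0,1])` -/

theorem Monotone.memLp_top_comp {Ω : Type*} [MeasurableSpace Ω] {P : Measure Ω} {U : Ω → I}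
    (hU : Measurable U) {g : I → ℝ} (hg : Monotone g) : MemLp (g ∘ U) ∞ P :=
  memLp_top_of_bound (hg.measurable.comp hU).aestronglyMeasurable (max |g 0| |g 1|)
    (Filter.Eventually.of_forall fun _ => abs_le_max_abs_abs (hg unitInterval.nonneg')
      (hg unitInterval.le_one'))

namespace RiskMeasure

variable {Ω : Type*} [MeasurableSpace Ω] {P : Measure Ω} {U : Ω → I}

/-- The random variable `g(U)` for a monotone function `g` on the unit interval. -/
noncomputable def monotoneComp (P : Measure Ω) (hU : Measurable U) {g : I → ℝ} (hg : Monotone g) : Lp ℝ ∞ P :=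
  (hg.memLp_top_comp hU (P := P)).toLp (g ∘ U)

theorem coeFn_monotoneComp (hU : Measurable U) {g : I → ℝ} (hg : Monotone g) :
    monotoneComp P hU hg =ᵐ[P] g ∘ U :=
  MemLp.coeFn_toLp _

theorem map_monotoneComp (hU : Measurable U) (hmap : P.map U = volume) {g : I → ℝ}
    (hg : Monotone g) : P.map (monotoneComp P hU hg) = (volume : Measure I).map g := by
  rw [Measure.map_congr (coeFn_monotoneComp hU hg), ← Measure.map_map hg.measurable hU, hmap]

theorem monotoneComp_le (hU : Measurable U) (hmap : P.map U = volume) {g h : I → ℝ}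
    (hg : Monotone g) (hh : Monotone h) (hgh : g ≤ᵐ[volume] h) :
    monotoneComp P hU hg ≤ monotoneComp P hU hh := by
  refine (Lp.coeFn_le _ _).1 ?_
  rw [← hmap] at hgh
  filter_upwards [coeFn_monotoneComp hU hg, coeFn_monotoneComp hU hh,
    ae_of_ae_map hU.aemeasurable hgh] with ω h₁ h₂ h₃
  rw [h₁, h₂]
  exact h₃

theorem monotoneComp_combination (hU : Measurable U) {g h : I → ℝ} (hg : Monotone g)
    (hh : Monotone h) {a b : ℝ} (hgh : Monotone (a • g + b • h)) :
    monotoneComp P hU hgh = a • monotoneComp P hU hg + b • monotoneComp P hU hh := by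
  refine Lp.ext ?_
  filter_upwards [coeFn_monotoneComp (P := P) hU hg, coeFn_monotoneComp (P := P) hU hh,
    coeFn_monotoneComp (P := P) hU hgh,
    Lp.coeFn_add (a • monotoneComp P hU hg) (b • monotoneComp P hU hh),
    Lp.coeFn_smul a (monotoneComp P hU hg), Lp.coeFn_smul b (monotoneComp P hU hh)]
    with ω h₁ h₂ h₃ h₄ h₅ h₆
  rw [h₃, h₄, Pi.add_apply, h₅, h₆, Pi.smul_apply, Pi.smul_apply, h₁, h₂]
  rfl

theorem monotoneComp_smul (hU : Measurable U) {g : I → ℝ} (hg : Monotone g) {a : ℝ}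
    (hag : Monotone (a • g)) : monotoneComp P hU hag = a • monotoneComp P hU hg := by
  have h := monotoneComp_combination (P := P) hU hg hg (a := a) (b := 0) (by simpa using hag)
  simpa using h

variable {ρ : Lp ℝ ∞ P → ℝ}

/-- The values of `ρ` on the variables `g(U)` with `g` monotone and dominated by `-f`. -/
noncomputable def hullValues (ρ : Lp ℝ ∞ P → ℝ) (hU : Measurable U) (f : Lp ℝ ∞ (volume : Measure I)) : Set ℝ :=
  {r | ∃ (g : I → ℝ) (hg : Monotone g), (∀ᵐ t, f t ≤ -g t) ∧ r = ρ (monotoneComp P hU hg)}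

/-- The extension of `f ↦ ρ (-f(U))` from antitone `f` to all of `L^∞([0, 1])`. -/
noncomputable def hull (ρ : Lp ℝ ∞ P → ℝ) (hU : Measurable U) (f : Lp ℝ ∞ (volume : Measure I)) : ℝ :=
  sInf (hullValues ρ hU f)

theorem hullValues_nonempty (hU : Measurable U) (f : Lp ℝ ∞ (volume : Measure I)) :
    (hullValues ρ hU f).Nonempty := by
  refine ⟨_, fun _ => -‖f‖, monotone_const, ?_, rfl⟩
  filter_upwards [FinAddProb.ae_abs_le_norm f] with t ht
  linarith [(abs_le.1 ht).2]

variable [IsProbabilityMeasure P]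

/-- Where the chosen representatives equal `g(U)` and `h(U)` exactly, both increments have the sign
dictated by the order of the values of `U`. -/
theorem comonotonic_monotoneComp (hU : Measurable U) {g h : I → ℝ}
    (hg : Monotone g) (hh : Monotone h) :
    Comonotonic (monotoneComp P hU hg) (monotoneComp P hU hh) := by
  refine ⟨{ω | monotoneComp P hU hg ω = g (U ω)} ∩ {ω | monotoneComp P hU hh ω = h (U ω)},
    ?_, ?_, ?_⟩
  · exact (measurableSet_eq_fun (Lp.stronglyMeasurable _).measurable (hg.measurable.comp hU)).inter
      (measurableSet_eq_fun (Lp.stronglyMeasurable _).measurable (hh.measurable.comp hU))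
  · rw [← measure_univ (μ := P)]
    refine measure_congr ?_
    filter_upwards [coeFn_monotoneComp hU hg, coeFn_monotoneComp hU hh] with ω h₁ h₂
    exact eq_true ⟨h₁, h₂⟩
  · rintro ω ⟨h₁, h₂⟩ ω' ⟨h₃, h₄⟩
    rw [Set.mem_ofPred_eq] at h₁ h₂ h₃ h₄
    rw [h₁, h₂, h₃, h₄]
    rcases le_total (U ω) (U ω') with h | h
    · exact mul_nonneg_of_nonpos_of_nonpos (sub_nonpos.2 (hg h)) (sub_nonpos.2 (hh h))
    · exact mul_nonneg (sub_nonneg.2 (hg h)) (sub_nonneg.2 (hh h))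

theorem monotoneComp_add_const (hU : Measurable U) {g : I → ℝ} (hg : Monotone g) {m : ℝ}
    (hgm : Monotone fun t => g t + m) :
    monotoneComp P hU hgm = monotoneComp P hU hg + Lp.const ∞ P m := by
  refine Lp.ext ?_
  filter_upwards [coeFn_monotoneComp (P := P) hU hg, coeFn_monotoneComp (P := P) hU hgm,
    Lp.coeFn_add (monotoneComp P hU hg) (Lp.const ∞ P m), Lp.coeFn_const ∞ P m] with ω h₁ h₂ h₃ h₄
  rw [h₂, h₃, Pi.add_apply, h₁, h₄]
  rfl

theorem bddBelow_hullValues (hρ : IsMonetary ρ) (hU : Measurable U) (hmap : P.map U = volume)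
    (f : Lp ℝ ∞ (volume : Measure I)) : BddBelow (hullValues ρ hU f) := by
  refine ⟨ρ (monotoneComp P hU (monotone_const (c := ‖f‖))), ?_⟩
  rintro _ ⟨g, hg, hgf, rfl⟩
  refine hρ.monotone _ _ (monotoneComp_le hU hmap _ _ ?_)
  filter_upwards [FinAddProb.ae_abs_le_norm f, hgf] with t h₁ h₂
  linarith [(abs_le.1 h₁).1]

theorem hull_le (hρ : IsMonetary ρ) (hU : Measurable U) (hmap : P.map U = volume)
    {f : Lp ℝ ∞ (volume : Measure I)} {g : I → ℝ} (hg : Monotone g) (hgf : ∀ᵐ t, f t ≤ -g t) :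
    hull ρ hU f ≤ ρ (monotoneComp P hU hg) :=
  csInf_le (bddBelow_hullValues hρ hU hmap f) ⟨g, hg, hgf, rfl⟩

/-- The function `g` is itself admissible, and any other competitor is at most `g` a.e., hence has
at least the same risk. -/
theorem hull_eq (hρ : IsMonetary ρ) (hU : Measurable U) (hmap : P.map U = volume)
    {f : Lp ℝ ∞ (volume : Measure I)} {g : I → ℝ} (hg : Monotone g) (hgf : ∀ᵐ t, f t = -g t) :
    hull ρ hU f = ρ (monotoneComp P hU hg) := by
  refine le_antisymm (hull_le hρ hU hmap hg (hgf.mono fun _ h => h.le))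
    (le_csInf (hullValues_nonempty hU f) ?_)
  rintro _ ⟨h, hh, hhf, rfl⟩
  refine hρ.monotone _ _ (monotoneComp_le hU hmap _ _ ?_)
  filter_upwards [hgf, hhf] with t h₁ h₂
  linarith

theorem monotone_hull (hρ : IsMonetary ρ) (hU : Measurable U) (hmap : P.map U = volume) :
    Monotone (hull ρ hU) := by
  intro f₁ f₂ hf
  refine le_csInf (hullValues_nonempty hU f₂) ?_
  rintro _ ⟨g, hg, hgf, rfl⟩
  refine hull_le hρ hU hmap hg ?_
  filter_upwards [hgf, (Lp.coeFn_le _ _).2 hf] with t h₁ h₂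
  exact h₂.trans h₁

theorem hull_add_const (hρ : IsMonetary ρ) (hU : Measurable U) (hmap : P.map U = volume)
    (f : Lp ℝ ∞ (volume : Measure I)) (m : ℝ) :
    hull ρ hU (f + Lp.const ∞ volume m) = hull ρ hU f + m := by
  have key : ∀ (f : Lp ℝ ∞ (volume : Measure I)) (m : ℝ),
      hull ρ hU (f + Lp.const ∞ volume m) ≤ hull ρ hU f + m := fun f m => by
    rw [← sub_le_iff_le_add]
    refine le_csInf (hullValues_nonempty hU f) ?_
    rintro _ ⟨g, hg, hgf, rfl⟩
    have hgm : Monotone fun t => g t + -m := fun s t hst => by linarith [hg hst]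
    have h := hull_le hρ hU hmap (f := f + Lp.const ∞ volume m) hgm (by
      filter_upwards [hgf, Lp.coeFn_add f (Lp.const ∞ volume m),
        Lp.coeFn_const ∞ (volume : Measure I) m] with t h₁ h₂ h₃
      rw [h₂, Pi.add_apply, h₃, Function.const_apply]
      linarith)
    rw [monotoneComp_add_const hU hg, hρ.translation] at h
    linarith
  refine le_antisymm (key f m) ?_
  -- The reverse inequality is the same one for the shifted function and the opposite shift.
  have h := key (f + Lp.const ∞ volume m) (-m)
  rw [add_assoc, ← map_add, add_neg_cancel, map_zero, add_zero] at h
  linarith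

/-- Convex combinations of nearly optimal competitors remain monotone and admissible. Convexity of
`ρ` is needed only for `g₁(U)` and `g₂(U)`, which are comonotonic. -/
theorem convexOn_hull (hρ : IsComConvex ρ) (hU : Measurable U) (hmap : P.map U = volume) :
    ConvexOn ℝ Set.univ (hull ρ hU) := by
  refine ⟨convex_univ, fun f₁ _ f₂ _ a b ha hb hab => ?_⟩
  refine le_of_forall_pos_le_add fun ε hε => ?_
  obtain ⟨_, ⟨g₁, hg₁, hgf₁, rfl⟩, h₁⟩ := exists_lt_of_csInf_lt (hullValues_nonempty hU f₁)
    (lt_add_of_pos_right (hull ρ hU f₁) hε)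
  obtain ⟨_, ⟨g₂, hg₂, hgf₂, rfl⟩, h₂⟩ := exists_lt_of_csInf_lt (hullValues_nonempty hU f₂)
    (lt_add_of_pos_right (hull ρ hU f₂) hε)
  have hg : Monotone (a • g₁ + b • g₂) := fun s t hst => by
    have h₃ := mul_le_mul_of_nonneg_left (hg₁ hst) ha
    have h₄ := mul_le_mul_of_nonneg_left (hg₂ hst) hb
    simp only [Pi.add_apply, Pi.smul_apply, smul_eq_mul]
    linarith
  have h := hull_le hρ.toIsMonetary hU hmap (f := a • f₁ + b • f₂) hg (by
    filter_upwards [hgf₁, hgf₂, Lp.coeFn_add (a • f₁) (b • f₂), Lp.coeFn_smul a f₁,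
      Lp.coeFn_smul b f₂] with t h₃ h₄ h₅ h₆ h₇
    have h₈ := mul_le_mul_of_nonneg_left h₃ ha
    have h₉ := mul_le_mul_of_nonneg_left h₄ hb
    rw [h₅, Pi.add_apply, h₆, h₇]
    simp only [Pi.add_apply, Pi.smul_apply, smul_eq_mul]
    linarith)
  obtain rfl : b = 1 - a := by linarith
  rw [monotoneComp_combination hU hg₁ hg₂] at h
  have hconv := hρ.com_convex _ _ (comonotonic_monotoneComp (P := P) hU hg₁ hg₂) a ha (by linarith)
  have h₃ := mul_le_mul_of_nonneg_left h₁.le ha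
  have h₄ := mul_le_mul_of_nonneg_left h₂.le hb
  rw [smul_eq_mul, smul_eq_mul]
  linarith

theorem hull_smul (hρ : IsMonetary ρ) (hhom : IsPosHomogeneous ρ) (hU : Measurable U)
    (hmap : P.map U = volume) (f : Lp ℝ ∞ (volume : Measure I)) (a : ℝ) (ha : 0 < a) :
    hull ρ hU (a • f) = a * hull ρ hU f := by
  have key : ∀ (f : Lp ℝ ∞ (volume : Measure I)) (a : ℝ), 0 < a →
      hull ρ hU (a • f) ≤ a * hull ρ hU f := fun f a ha => by
    rw [← div_le_iff₀' ha]
    refine le_csInf (hullValues_nonempty hU f) ?_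
    rintro _ ⟨g, hg, hgf, rfl⟩
    have hag : Monotone (a • g) := fun s t hst => mul_le_mul_of_nonneg_left (hg hst) ha.le
    rw [div_le_iff₀' ha, ← hhom _ _ ha.le, ← monotoneComp_smul hU hg hag]
    refine hull_le hρ hU hmap hag ?_
    filter_upwards [hgf, Lp.coeFn_smul a f] with t h₁ h₂
    rw [h₂, Pi.smul_apply, Pi.smul_apply, smul_eq_mul, smul_eq_mul, ← mul_neg]
    exact mul_le_mul_of_nonneg_left h₁ ha.le
  refine le_antisymm (key f a ha) ?_
  have h := key (a • f) a⁻¹ (inv_pos.2 ha)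
  rw [inv_smul_smul₀ ha.ne', inv_mul_eq_div, le_div_iff₀' ha] at h
  exact h

/-- Law-invariance enters here: `X` and `q_X(U)` have the same distribution, so the extension at the
class of `VaR X` returns `ρ X`. -/
theorem exists_toLp_VaR (hρ : IsMonetary ρ) (hlaw : IsLawInvariant ρ) (hU : Measurable U)
    (hmap : P.map U = volume) (X : Lp ℝ ∞ P) :
    ∃ f : Lp ℝ ∞ (volume : Measure I), hull ρ hU f = ρ X ∧
      ∀ μ : FinAddProb (volume : Measure I), μ.integral (VaR X) = μ.integral f := by
  have hq := monotone_monotoneQuantile X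
  have hmem := ((hq.memLp_top_comp measurable_id) : MemLp _ ∞ (volume : Measure I)).neg
  have hf : ∀ᵐ t, hmem.toLp (-monotoneQuantile X ∘ id) t = -monotoneQuantile X t := hmem.coeFn_toLp
  refine ⟨hmem.toLp _, ?_, fun μ => μ.integral_congr_ae ?_⟩
  · rw [hull_eq hρ hU hmap hq hf]
    exact hlaw _ _ ((map_monotoneComp hU hmap hq).trans (map_monotoneQuantile X))
  · filter_upwards [hf, monotoneQuantile_ae_eq X] with t h₁ h₂
    rw [h₁, h₂, VaR]

end RiskMeasure

theorem mainTheorem11 {Ω : Type*} [MeasurableSpace Ω] (P : Measure Ω) [IsProbabilityMeasure P]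
    (hP : RiskMeasure.IsNonatomic P) (ρ : Lp ℝ ∞ P → ℝ)
    (hlaw : RiskMeasure.IsLawInvariant ρ) :
    (RiskMeasure.IsComConvex ρ →
      ∃ α : FinAddProb (volume : Measure I) → EReal,
        (∀ μ, α μ ≠ ⊥) ∧ LowerSemicontinuous α ∧ FinAddProb.IsConvexFunctional α ∧
        ∀ X : Lp ℝ ∞ P, IsGreatest
          (Set.range fun μ : FinAddProb (volume : Measure I) =>
            ((μ.integral (RiskMeasure.VaR X) : ℝ) : EReal) - α μ)
          ((ρ X : ℝ) : EReal)) ∧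
    (RiskMeasure.IsComCoherent ρ →
      ∃ M : Set (FinAddProb (volume : Measure I)),
        M.Nonempty ∧ IsCompact M ∧ FinAddProb.IsConvexSet M ∧
        ∀ X : Lp ℝ ∞ P, IsGreatest
          ((fun μ : FinAddProb (volume : Measure I) => μ.integral (RiskMeasure.VaR X)) '' M)
          (ρ X)) := by
  obtain ⟨U, hU, hmap⟩ := exists_map_eq_volume_unitInterval hP
  refine ⟨fun hρ => ?_, fun hρ => ?_⟩
  · obtain ⟨α, h₁, h₂, h₃, h₄⟩ := FinAddProb.exists_penalty
      (RiskMeasure.convexOn_hull hρ hU hmap) (RiskMeasure.monotone_hull hρ.toIsMonetary hU hmap)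
      (RiskMeasure.hull_add_const hρ.toIsMonetary hU hmap)
    refine ⟨α, h₁, h₂, h₃, fun X => ?_⟩
    obtain ⟨f, hf, hint⟩ := RiskMeasure.exists_toLp_VaR hρ.toIsMonetary hlaw hU hmap X
    simp only [hint, ← hf]
    exact h₄ f
  · obtain ⟨M, h₁, h₂, h₃, h₄⟩ := FinAddProb.exists_isCompact_representation
      (RiskMeasure.convexOn_hull hρ.toIsComConvex hU hmap)
      (RiskMeasure.monotone_hull hρ.toIsMonetary hU hmap)
      (RiskMeasure.hull_add_const hρ.toIsMonetary hU hmap)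
      (RiskMeasure.hull_smul hρ.toIsMonetary hρ.pos_hom hU hmap)
    refine ⟨M, h₁, h₂, h₃, fun X => ?_⟩
    obtain ⟨f, hf, hint⟩ := RiskMeasure.exists_toLp_VaR hρ.toIsMonetary hlaw hU hmap X
    simp only [hint, ← hf]
    exact h₄ f
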